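/- Let $G$ be a (real) Lie group whose Lie algebra $\mathfrak g$ is semisimple and equipped with a $|k|$-grading $\mathfrak g=\mathfrak g_{-k}\oplus\dots\oplus\mathfrak g_k$, $[\mathfrak g_i,\mathfrak g_j]\subset\mathfrak g_{i+j}$, such that no simple ideal of $\mathfrak g$ is contained in $\mathfrak g_0$ and $\mathfrak g_-=\mathfrak g_{-k}\oplus\dots\oplus\mathfrak g_{-1}$ is generated by $\mathfrak g_{-1}$. Let $G_0\subset G$ be the closed Lie subgroup of all elements whose adjoint action leaves each $\mathfrak g_i$ invariant; its Lie algebra is $\mathfrak g_0$. An infinitesimal flag structure of type $\mathfrak g/\mathfrak p$ on a smooth manifold $M$ consists of a filtration $TM=T^{-k}M\supset\dots\supset T^{-1}M\supset T^0M=0$ by smooth subbundles and of a reduction of $\operatorname{Gr}TM=\bigoplus_{i<0}T^iM/T^{i+1}M$ to the structure group $G_0$, i.e. a smooth principal $G_0$-bundle $p_0:\mathcal G_0\to M$ together with linear isomorphisms $\theta_i(u):T^i_xM/T^{i+1}_xM\to\mathfrak g_i$ for $u\in\mathcal G_0$, $x=p_0(u)$, $i<0$, which depend smoothly on $u$ and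 satisfy $\theta_i(u\cdot g)=\operatorname{Ad}(g^{-1})\circ\theta_i(u)$ for $g\in G_0$. It is regular if for all $i,j<0$ and all local smooth sections $\xi$ of $T^iM$ and $\eta$ of $T^jM$ the Lie bracket $[\xi,\eta]$ is a section of $T^{i+j}M$ (where $T^lM=TM$ for $l\le -k$), and the class of $[\xi,\eta]$ in $T^{i+j}M/T^{i+j+1}M$ satisfies $\theta_{i+j}([\xi,\eta])=[\theta_i(\xi),\theta_j(\eta)]$. A Weyl form is a smooth one-form $\tau\in\Omega^1(\mathcal G_0,\mathfrak g)$ such that $(r^g)^*\tau=\operatorname{Ad}(g^{-1})\circ\tau$ for $g\in G_0$, $\tau(\zeta_A)=A$ for the fundamental vector field $\zeta_A$ of each $A\in\mathfrak g_0$, and such that for each $i<0$ and each $\xi\in T_u\mathcal G_0$ with $Tp_0\cdot\xi\in T^iM$ the $\mathfrak g_i$-component satisfies $\tau_i(\xi)=\theta_i(u)(Tp_0\cdot\xi)$. Its Weyl curvature is the $\mathfrak g$-valued two-form $W(\xi,\eta)=d\tau(\xi,\eta)+[\tau(\xi),\tau(\eta)]$ on $\mathcal G_0$. Via lifts through the $\mathfrak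 g_-$-component $\tau_-=\tau_{-k}\oplus\dots\oplus\tau_{-1}$, it is viewed at each $u\in\mathcal G_0$ as a map on $\mathfrak g_-\times\mathfrak g_-$ with values in $\mathfrak g$: $W_u(X,Y)=W(\xi,\eta)$ where $\xi,\eta\in T_u\mathcal G_0$ satisfy $\tau_-(\xi)=X$ and $\tau_-(\eta)=Y$. Its homogeneous component $W^{(\ell)}$ of degree $\ell$ is given on $\mathfrak g_i\times\mathfrak g_j$, $i,j<0$, by the $\mathfrak g_{i+j+\ell}$-component of $W_u$. Then, for every regular infinitesimal flag structure, every Weyl form $\tau$ and every $u\in\mathcal G_0$, each element of $\mathfrak g_-$ has a lift to $T_u\mathcal G_0$ through $\tau_-$, and for every choice of lifts $W^{(\ell)}=0$ for all $\ell\le 0$. -/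

import Mathlib

open scoped Manifold ContDiff

noncomputable section

/-- Over `ℝ`, the regularity that Mathlib asks of a Lie group in order to define its Lie algebra is
finite, so that a smooth Lie group has a Lie algebra. -/
instance minSmoothness_real_LEInfty : ENat.LEInfty (minSmoothness ℝ 3) where
  out := by
    rw [minSmoothness_of_isRCLikeNormedField]
    exact WithTop.coe_le_coe.2 le_top

namespace WeylGeometry

/-! ### Graded Lie algebras -/

/-- A `|k|`-grading `L = L_{-k} ⊕ ⋯ ⊕ L_k` of a real semisimple Lie algebra `L` such that no simple
ideal of `L` is contained in `L_0` and such that `L_- = L_{-k} ⊕ ⋯ ⊕ L_{-1}` is generated, as a Lie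
algebra, by `L_{-1}`. -/
structure EffectiveGrading (L : Type*) [LieRing L] [LieAlgebra ℝ L] (k : ℕ) where
  semisimple : LieAlgebra.IsSemisimple ℝ L
  piece : ℤ → Submodule ℝ L
  isInternal : DirectSum.IsInternal piece
  lie_mem : ∀ (i j : ℤ) (x y : L), x ∈ piece i → y ∈ piece j → ⁅x, y⁆ ∈ piece (i + j)
  eq_bot : ∀ i : ℤ, (k : ℤ) < |i| → piece i = ⊥
  not_le_zero : ∀ J : LieIdeal ℝ L, LieAlgebra.IsSimple ℝ J → ¬ (J : Set L) ⊆ piece 0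
  generated : (LieSubalgebra.lieSpan ℝ L (piece (-1) : Set L)).toSubmodule =
    ⨆ i : ℤ, ⨆ _ : i < 0, piece i

namespace EffectiveGrading

variable {L : Type*} [LieRing L] [LieAlgebra ℝ L] {k : ℕ} (gr : EffectiveGrading L k)

/-- The negative part `L_-`. -/
def neg : Submodule ℝ L := ⨆ i : ℤ, ⨆ _ : i < 0, gr.piece i

/-- The projection `L → L_i ⊆ L` onto the component of degree `i`. -/
def proj (i : ℤ) : L →ₗ[ℝ] L :=
  (gr.piece i).subtype ∘ₗ DirectSum.component ℝ ℤ (fun j => gr.piece j) i ∘ₗ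
    (LinearEquiv.ofBijective (DirectSum.coeLinearMap gr.piece) gr.isInternal).symm.toLinearMap

/-- The projection `L → L_- ⊆ L`. -/
def negProj : L →ₗ[ℝ] L := ∑ i ∈ Finset.Icc (-(k : ℤ)) (-1), gr.proj i

/-- The homogeneous part `Φ^{(ℓ)}` of degree `ℓ` of a bilinear map `Φ : L_- × L_- → L`, i.e. the
bilinear map that coincides with the component of `Φ` in `L_{i+j+ℓ}` on each `L_i × L_j`,
`i, j < 0`. -/
def homogeneousPart (ℓ : ℤ) (Φ : L → L → L) (X Y : L) : L :=
  ∑ i ∈ Finset.Icc (-(k : ℤ)) (-1), ∑ j ∈ Finset.Icc (-(k : ℤ)) (-1),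
    gr.proj (i + j + ℓ) (Φ (gr.proj i X) (gr.proj j Y))

end EffectiveGrading

/-! ### The adjoint action and the group `G₀` -/

section Group

variable {EG : Type*} [NormedAddCommGroup EG] [NormedSpace ℝ EG]
  {G : Type*} [TopologicalSpace G] [ChartedSpace EG G] [Group G]

/-- The adjoint action of `g : G` on the Lie algebra of `G`: the derivative at the identity of the
conjugation by `g`. -/
def Ad (g : G) : GroupLieAlgebra 𝓘(ℝ, EG) G →L[ℝ] GroupLieAlgebra 𝓘(ℝ, EG) G :=
  mfderiv 𝓘(ℝ, EG) 𝓘(ℝ, EG) (fun x : G => g * x * g⁻¹) 1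

theorem mfderiv_congr_one (f : G → G) (x : G) (hx : x = 1) :
    (mfderiv 𝓘(ℝ, EG) 𝓘(ℝ, EG) f x : EG →L[ℝ] EG) = mfderiv 𝓘(ℝ, EG) 𝓘(ℝ, EG) f 1 := by
  subst hx; rfl

theorem Ad_one : Ad (EG := EG) (1 : G) = ContinuousLinearMap.id ℝ _ := by
  have h : (fun x : G => (1 : G) * x * (1 : G)⁻¹) = id := by ext x; simp
  unfold Ad
  rw [h]
  exact mfderiv_id

theorem Ad_mul [LieGroup 𝓘(ℝ, EG) ∞ G] (g h : G) (X : GroupLieAlgebra 𝓘(ℝ, EG) G) :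
    Ad (g * h) X = Ad g (Ad h X) := by
  have hs : ∀ a x : G, MDifferentiableAt 𝓘(ℝ, EG) 𝓘(ℝ, EG) (fun x : G => a * x * a⁻¹) x := by
    intro a x
    have : ContMDiff 𝓘(ℝ, EG) 𝓘(ℝ, EG) ∞ (fun x : G => a * x * a⁻¹) :=
      (contMDiff_const.mul contMDiff_id).mul contMDiff_const
    exact this.mdifferentiableAt (by simp)
  have hc : (fun x : G => (g * h) * x * (g * h)⁻¹) =
      (fun x : G => g * x * g⁻¹) ∘ (fun x : G => h * x * h⁻¹) := by
    ext x; simp [mul_assoc]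
  have h1 : mfderiv 𝓘(ℝ, EG) 𝓘(ℝ, EG) (fun x : G => (g * h) * x * (g * h)⁻¹) 1 =
      (mfderiv 𝓘(ℝ, EG) 𝓘(ℝ, EG) (fun x : G => g * x * g⁻¹) (h * 1 * h⁻¹)).comp
        (mfderiv 𝓘(ℝ, EG) 𝓘(ℝ, EG) (fun x : G => h * x * h⁻¹) 1) := by
    rw [hc]
    exact mfderiv_comp (I' := 𝓘(ℝ, EG)) 1 (hs g _) (hs h _)
  have h2 := mfderiv_congr_one (EG := EG) (fun x : G => g * x * g⁻¹) (h * 1 * h⁻¹) (by simp)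
  have h3 := DFunLike.congr_fun h1 X
  exact h3.trans (DFunLike.congr_fun h2 _)

variable [FiniteDimensional ℝ EG]

instance completeSpace_of_finiteDimensional_real : CompleteSpace EG := FiniteDimensional.complete ℝ EG

variable [LieGroup 𝓘(ℝ, EG) ∞ G]

/-- The subgroup `G₀ ⊆ G` of all elements whose adjoint action leaves the grading invariant. -/
def levi {k : ℕ} (gr : EffectiveGrading (GroupLieAlgebra 𝓘(ℝ, EG) G) k) : Subgroup G where
  carrier := {g | ∀ (i : ℤ) (X : GroupLieAlgebra 𝓘(ℝ, EG) G), Ad g X ∈ gr.piece i ↔ X ∈ gr.piece i}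
  one_mem' := by intro i X; rw [Ad_one]; rfl
  mul_mem' := by
    intro a b ha hb i X
    rw [Ad_mul, ha, hb]
  inv_mem' := by
    intro a ha i X
    rw [← ha, ← Ad_mul, mul_inv_cancel, Ad_one]; rfl

end Group

/-! ### Smooth principal bundles, smooth subbundles, exterior derivative -/

section Bundles

variable {EM : Type*} [NormedAddCommGroup EM] [NormedSpace ℝ EM]
  {M : Type*} [TopologicalSpace M] [ChartedSpace EM M]
  {EB : Type*} [NormedAddCommGroup EB] [NormedSpace ℝ EB]
  {B : Type*} [TopologicalSpace B] [ChartedSpace EB B]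

/-- `p : B → M` is a smooth principal bundle for the right action of the Lie group `H` on `B`: the
action is smooth, and `B` is locally `H`-equivariantly diffeomorphic to `U × H`, with `p`
corresponding to the projection to `U`. -/
structure IsPrincipalBundle {EH : Type*} [NormedAddCommGroup EH] [NormedSpace ℝ EH]
    (H : Type*) [TopologicalSpace H] [ChartedSpace EH H] [Group H]
    [MulAction Hᵐᵒᵖ B] (p : B → M) : Prop where
  contMDiff_action : ContMDiff (𝓘(ℝ, EB).prod 𝓘(ℝ, EH)) 𝓘(ℝ, EB) ∞
    (fun q : B × H => MulOpposite.op q.2 • q.1)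
  contMDiff_proj : ContMDiff 𝓘(ℝ, EB) 𝓘(ℝ, EM) ∞ p
  locally_trivial : ∀ x : M, ∃ (U : Set M) (φ : OpenPartialHomeomorph (M × H) B),
    IsOpen U ∧ x ∈ U ∧ φ.source = U ×ˢ Set.univ ∧ φ.target = p ⁻¹' U ∧
    ContMDiffOn (𝓘(ℝ, EM).prod 𝓘(ℝ, EH)) 𝓘(ℝ, EB) ∞ φ φ.source ∧
    ContMDiffOn 𝓘(ℝ, EB) (𝓘(ℝ, EM).prod 𝓘(ℝ, EH)) ∞ φ.symm φ.target ∧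
    (∀ y ∈ U, ∀ h : H, p (φ (y, h)) = y) ∧
    ∀ y ∈ U, ∀ h h' : H, φ (y, h * h') = MulOpposite.op h' • φ (y, h)

variable [IsManifold 𝓘(ℝ, EM) ∞ M]

/-- The vector field `ξ` on `M` is smooth on the set `U`. -/
def SmoothFieldOn (ξ : ∀ x : M, TangentSpace 𝓘(ℝ, EM) x) (U : Set M) : Prop :=
  ContMDiffOn 𝓘(ℝ, EM) 𝓘(ℝ, EM).tangent ∞
    (fun x => (⟨x, ξ x⟩ : TangentBundle 𝓘(ℝ, EM) M)) U

/-- The family `D` of subspaces of the tangent spaces is a smooth subbundle of `TM`: locally, it has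
a smooth frame. -/
def IsSmoothSubbundle (D : ∀ x : M, Submodule ℝ (TangentSpace 𝓘(ℝ, EM) x)) : Prop :=
  ∀ x : M, ∃ (U : Set M) (r : ℕ) (e : Fin r → ∀ y : M, TangentSpace 𝓘(ℝ, EM) y),
    IsOpen U ∧ x ∈ U ∧ (∀ a, SmoothFieldOn (e a) U) ∧
    ∀ y ∈ U, LinearIndependent ℝ (fun a => e a y) ∧ Submodule.span ℝ (Set.range fun a => e a y) = D y

/-- The exterior derivative `dα(ξ, η)` of a one-form `α` on `B` with values in `V`, for
`ξ, η ∈ T_u B`, computed in the chart at `u`. Normalization: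
`dα(ξ, η) = ξ ⬝ α(η) - η ⬝ α(ξ) - α([ξ, η])` for vector fields `ξ`, `η`. -/
def exteriorDerivative {V : Type*} [NormedAddCommGroup V] [NormedSpace ℝ V]
    (α : ∀ u : B, TangentSpace 𝓘(ℝ, EB) u →L[ℝ] V) (u : B) (ξ η : TangentSpace 𝓘(ℝ, EB) u) : V :=
  let φ := extChartAt 𝓘(ℝ, EB) u
  let αφ : EB → EB →L[ℝ] V := fun y =>
    (α (φ.symm y)).comp (mfderiv 𝓘(ℝ, EB) 𝓘(ℝ, EB) φ.symm y)
  extDeriv (fun y => ContinuousAlternatingMap.ofSubsingleton ℝ EB V (0 : Fin 1) (αφ y)) (φ u)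
    ![mfderiv 𝓘(ℝ, EB) 𝓘(ℝ, EB) φ u ξ, mfderiv 𝓘(ℝ, EB) 𝓘(ℝ, EB) φ u η]

end Bundles

/-! ### Infinitesimal flag structures and Weyl forms -/

section Flag

variable {EG : Type*} [NormedAddCommGroup EG] [NormedSpace ℝ EG] [FiniteDimensional ℝ EG]
  {G : Type*} [TopologicalSpace G] [ChartedSpace EG G] [Group G] [LieGroup 𝓘(ℝ, EG) ∞ G]
  (EM EB : Type*) {k : ℕ} (gr : EffectiveGrading (GroupLieAlgebra 𝓘(ℝ, EG) G) k)
  [NormedAddCommGroup EM] [NormedSpace ℝ EM]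
  {M : Type*} [TopologicalSpace M] [ChartedSpace EM M] [IsManifold 𝓘(ℝ, EM) ∞ M]
  [NormedAddCommGroup EB] [NormedSpace ℝ EB]
  {B : Type*} [TopologicalSpace B] [ChartedSpace EB B] [IsManifold 𝓘(ℝ, EB) ∞ B]
  [MulAction (levi gr)ᵐᵒᵖ B] (p : B → M)

/-- A filtration `TM = T^{-k}M ⊇ ⋯ ⊇ T^{-1}M ⊇ T^0 M = 0` of the tangent bundle by smooth
subbundles, together with a reduction of the structure group of the associated graded bundle
`Gr TM` to `G₀`, with `p : B → M` as the principal bundle of the reduction: each `u ∈ B` over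
`x ∈ M` is a frame of `Gr T_x M`, i.e. it provides linear isomorphisms
`T^i_x M / T^{i+1}_x M ≅ g_i`, `i < 0`, which depend smoothly and `G₀`-equivariantly on `u`. -/
structure InfinitesimalFlagStructure where
  filtration : ℤ → ∀ x : M, Submodule ℝ (TangentSpace 𝓘(ℝ, EM) x)
  antitone : ∀ x : M, Antitone fun i => filtration i x
  eq_top : ∀ i : ℤ, i ≤ -(k : ℤ) → ∀ x, filtration i x = ⊤
  eq_bot : ∀ i : ℤ, 0 ≤ i → ∀ x, filtration i x = ⊥
  isSmoothSubbundle : ∀ i : ℤ, IsSmoothSubbundle (filtration i)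
  frame : ∀ {x : M} (u : B), p u = x → ∀ i : ℤ, i < 0 →
    (filtration i x ⧸ (filtration (i + 1) x).submoduleOf (filtration i x)) ≃ₗ[ℝ] gr.piece i
  frame_equivariant : ∀ {x : M} (u : B) (g : levi gr) (hu : p u = x)
    (hug : p (MulOpposite.op g • u) = x) (i : ℤ) (hi : i < 0)
    (v : filtration i x ⧸ (filtration (i + 1) x).submoduleOf (filtration i x)),
    (frame (MulOpposite.op g • u) hug i hi v : GroupLieAlgebra 𝓘(ℝ, EG) G) =
      Ad (g : G)⁻¹ (frame u hu i hi v : GroupLieAlgebra 𝓘(ℝ, EG) G)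
  frame_smooth : ∀ (i : ℤ) (hi : i < 0) (U : Set M), IsOpen U → ∀ ξ : (∀ x, filtration i x),
    SmoothFieldOn (fun x => (ξ x : TangentSpace 𝓘(ℝ, EM) x)) U →
    ContMDiffOn (M' := EG) 𝓘(ℝ, EB) 𝓘(ℝ, EG) ∞
      (fun u : B => (frame u rfl i hi (Submodule.Quotient.mk (ξ (p u))) :
        GroupLieAlgebra 𝓘(ℝ, EG) G))
      (p ⁻¹' U)

variable {EM EB gr p}

namespace InfinitesimalFlagStructure

/-- The structure is regular: the Lie bracket of vector fields is compatible with the filtration,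
i.e. `[ξ, η]` is a section of `T^{i+j}M` for sections `ξ` of `T^i M` and `η` of `T^j M`, and the
bracket that it induces on `Gr TM` coincides with the one that each frame transfers from `g_-`. -/
def IsRegular (F : InfinitesimalFlagStructure EM EB gr p) : Prop :=
  ∀ (i j : ℤ) (hi : i < 0) (hj : j < 0) (U : Set M), IsOpen U →
    ∀ (ξ : ∀ x, F.filtration i x) (η : ∀ x, F.filtration j x),
    SmoothFieldOn (fun x => (ξ x : TangentSpace 𝓘(ℝ, EM) x)) U →
    SmoothFieldOn (fun x => (η x : TangentSpace 𝓘(ℝ, EM) x)) U →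
    ∀ x ∈ U, ∃ h : VectorField.mlieBracket 𝓘(ℝ, EM) (fun y => (ξ y : TangentSpace 𝓘(ℝ, EM) y))
        (fun y => (η y : TangentSpace 𝓘(ℝ, EM) y)) x ∈ F.filtration (i + j) x,
      ∀ (u : B) (hu : p u = x),
        (F.frame u hu (i + j) (add_neg hi hj) (Submodule.Quotient.mk ⟨_, h⟩) :
            GroupLieAlgebra 𝓘(ℝ, EG) G) =
          ⁅(F.frame u hu i hi (Submodule.Quotient.mk (ξ x)) : GroupLieAlgebra 𝓘(ℝ, EG) G),
            (F.frame u hu j hj (Submodule.Quotient.mk (η x)) : GroupLieAlgebra 𝓘(ℝ, EG) G)⁆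

/-- The component `θ_i`, `i < 0`, of the frame form of degree one: for
`ξ ∈ T^i_u B = (T_u p)⁻¹ (T^i M)`, the element of `g_i` that corresponds to the class of `T_u p ξ`
in `T^i M / T^{i+1} M` under the frame `u`. -/
def frameForm (F : InfinitesimalFlagStructure EM EB gr p) (i : ℤ) (hi : i < 0) (u : B)
    (ξ : TangentSpace 𝓘(ℝ, EB) u)
    (hξ : mfderiv 𝓘(ℝ, EB) 𝓘(ℝ, EM) p u ξ ∈ F.filtration i (p u)) :
    GroupLieAlgebra 𝓘(ℝ, EG) G :=
  F.frame u rfl i hi (Submodule.Quotient.mk ⟨_, hξ⟩)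

end InfinitesimalFlagStructure

variable (E₀ : Type*) [NormedAddCommGroup E₀] [NormedSpace ℝ E₀]

/-- A Weyl form: a smooth one-form `τ` on the total space `B` with values in the Lie algebra `g` of
`G` which is `G₀`-equivariant, reproduces the generators of fundamental vector fields (the Lie
algebra of `G₀`, as a subalgebra of `g`, is the range of the derivative of the inclusion), and whose
component `τ_i` restricts on `T^i B` to the component `θ_i` of the frame form, for each `i < 0`. -/
structure WeylForm (F : InfinitesimalFlagStructure EM EB gr p) [ChartedSpace E₀ (levi gr)] where
  toFun : ∀ u : B, TangentSpace 𝓘(ℝ, EB) u →L[ℝ] GroupLieAlgebra 𝓘(ℝ, EG) G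
  smooth : ContMDiff (M' := EG) 𝓘(ℝ, EB).tangent 𝓘(ℝ, EG) ∞
    (fun v : TangentBundle 𝓘(ℝ, EB) B => toFun v.proj v.snd)
  equivariant : ∀ (g : levi gr) (u : B) (ξ : TangentSpace 𝓘(ℝ, EB) u),
    toFun (MulOpposite.op g • u)
        (mfderiv 𝓘(ℝ, EB) 𝓘(ℝ, EB) (fun v : B => MulOpposite.op g • v) u ξ) =
      Ad (g : G)⁻¹ (toFun u ξ)
  fundamental : ∀ (u : B) (A : TangentSpace 𝓘(ℝ, E₀) (1 : levi gr)),
    toFun (MulOpposite.op (1 : levi gr) • u)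
        (mfderiv 𝓘(ℝ, E₀) 𝓘(ℝ, EB) (fun g : levi gr => MulOpposite.op g • u) 1 A) =
      mfderiv 𝓘(ℝ, E₀) 𝓘(ℝ, EG) (Subtype.val : levi gr → G) 1 A
  eq_frameForm : ∀ (i : ℤ) (hi : i < 0) (u : B) (ξ : TangentSpace 𝓘(ℝ, EB) u)
    (hξ : mfderiv 𝓘(ℝ, EB) 𝓘(ℝ, EM) p u ξ ∈ F.filtration i (p u)),
    gr.proj i (toFun u ξ) = F.frameForm i hi u ξ hξ

namespace WeylForm

variable {E₀} {F : InfinitesimalFlagStructure EM EB gr p} [ChartedSpace E₀ (levi gr)]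
  (τ : WeylForm E₀ F)

/-- The Weyl curvature `W(ξ, η) = dτ(ξ, η) + [τ(ξ), τ(η)]`, a two-form on `B` with values in `g`. -/
def curvature (u : B) (ξ η : TangentSpace 𝓘(ℝ, EB) u) : GroupLieAlgebra 𝓘(ℝ, EG) G :=
  let dτ : GroupLieAlgebra 𝓘(ℝ, EG) G := exteriorDerivative (V := EG) τ.toFun u ξ η
  dτ + ⁅τ.toFun u ξ, τ.toFun u η⁆

/-- `σ` lifts the elements of `g_-` to `T_u B` through `τ_-`. As `τ_-` is horizontal, this amounts to
the identification of `g_-` with `T_{p(u)} M` by `τ_-`, followed by a lift of tangent vectors of `M`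
to tangent vectors of `B`. -/
def IsLift (u : B) (σ : GroupLieAlgebra 𝓘(ℝ, EG) G → TangentSpace 𝓘(ℝ, EB) u) : Prop :=
  ∀ X ∈ gr.neg, gr.negProj (τ.toFun u (σ X)) = X

/-- The Weyl curvature at `u`, viewed through the identification of `T_{p(u)} M` with `g_-` given by
`τ_-` as a map on `g_- × g_-`: the vectors are lifted to `T_u B` and inserted into `W`. -/
def curvatureFunction (u : B) (σ : GroupLieAlgebra 𝓘(ℝ, EG) G → TangentSpace 𝓘(ℝ, EB) u)
    (X Y : GroupLieAlgebra 𝓘(ℝ, EG) G) : GroupLieAlgebra 𝓘(ℝ, EG) G :=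
  τ.curvature u (σ X) (σ Y)

end WeylForm

end Flag

end WeylGeometry

end

/-! Take `i, j < 0` and lifts `ξ`, `η` of elements of `g_i` and `g_j`. Since the components of
`τ(ξ)` below degree `i` vanish, `ξ` projects into `T^i M` (`mem_filtration`); likewise `η` projects
into `T^j M`. Extend the projections to local sections of these subbundles, and lift those to vector
fields near `u` through `ξ` and `η`. For `m ≤ i + j` one has `m < i`, `m < j` and `m < 0`, so `τ_m`
vanishes along both fields (`proj_eq_zero`), and in the formula for `dτ_m` only `-τ_m([ξ, η])`
survives (`exists_exteriorDerivative_eq`). The bracket projects to the bracket on `M`, so by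
regularity this term is `-[τ_i(ξ), τ_j(η)]` if `m = i + j`, and zero if `m < i + j`. The algebraic
term `[τ(ξ), τ(η)]` has exactly the opposite component (`proj_lie`): the unspecified components of
nonnegative degree of a lift cannot reach degrees this low. The two terms cancel (`proj_curvature`),
which covers all `ℓ ≤ 0` at once. Lifts exist because the frames determine `τ_-` degree by degree
and `p` is a submersion (`exists_lift`). -/

namespace WeylGeometry

open VectorField Filter Topology

/-! ### Related vector fields and exterior derivatives in normed spaces. -/

section Flat

variable {E F V : Type*} [NormedAddCommGroup E] [NormedSpace ℝ E]
  [NormedAddCommGroup F] [NormedSpace ℝ F] [NormedAddCommGroup V] [NormedSpace ℝ V]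

/-- A vector field lifts through a submersion, with a prescribed value at one point. -/
theorem exists_related_vectorField [FiniteDimensional ℝ F] {P : E → F} {y₀ : E}
    (hP : ContDiffAt ℝ 2 P y₀) (hs : Function.Surjective (fderiv ℝ P y₀)) {X : F → F}
    (hX : DifferentiableAt ℝ X (P y₀)) {v₀ : E} (hv₀ : fderiv ℝ P y₀ v₀ = X (P y₀)) :
    ∃ Z : E → E, DifferentiableAt ℝ Z y₀ ∧ Z y₀ = v₀ ∧
      ∀ᶠ y in 𝓝 y₀, fderiv ℝ P y (Z y) = X (P y) := by
  have : CompleteSpace F := FiniteDimensional.complete ℝ F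
  obtain ⟨S, hS⟩ := (fderiv ℝ P y₀).exists_rightInverse_of_surjective
    (LinearMap.range_eq_top.2 hs)
  -- With `S` a fixed right inverse at `y₀`, `A` is the identity at `y₀`, hence invertible nearby,
  -- and `S ∘ A⁻¹` is a right inverse of the derivative at `y`.
  let A : E → F →L[ℝ] F := fun y => (fderiv ℝ P y).comp S
  have hdP : DifferentiableAt ℝ (fderiv ℝ P) y₀ :=
    (hP.fderiv_right (m := 1) (by norm_num)).differentiableAt one_ne_zero
  have hA : DifferentiableAt ℝ A y₀ := hdP.clm_comp (differentiableAt_const S)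
  have hA₀ : A y₀ = (ContinuousLinearEquiv.refl ℝ F : F →L[ℝ] F) := hS
  have hinv : DifferentiableAt ℝ (fun y => (A y).inverse) y₀ := by
    have h := (contDiffAt_map_inverse (n := 1) (ContinuousLinearEquiv.refl ℝ F)).differentiableAt
      one_ne_zero
    rw [← hA₀] at h
    exact h.comp y₀ hA
  have hev : ∀ᶠ y in 𝓝 y₀, ∃ e : F ≃L[ℝ] F, (e : F →L[ℝ] F) = A y := by
    have h := ContinuousLinearEquiv.nhds (ContinuousLinearEquiv.refl ℝ F)
    rw [← hA₀] at h
    exact hA.continuousAt h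
  -- The constant field `v₀`, corrected by its failure to be related to `X`; the correction vanishes
  -- at `y₀` by `hv₀`.
  refine ⟨fun y => v₀ + S ((A y).inverse (X (P y) - fderiv ℝ P y v₀)), ?_, ?_, ?_⟩
  · have hXP : DifferentiableAt ℝ (fun y => X (P y)) y₀ :=
      hX.comp y₀ (hP.differentiableAt two_ne_zero)
    exact (S.differentiableAt.comp y₀ (hinv.clm_apply
      (hXP.sub (hdP.clm_apply (differentiableAt_const v₀))))).const_add v₀
  · simp [hv₀]
  · filter_upwards [hev] with y ⟨e, he⟩
    have h : ∀ z, fderiv ℝ P y (S ((A y).inverse z)) = z := by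
      intro z
      change A y ((A y).inverse z) = z
      rw [← he, ContinuousLinearMap.inverse_equiv]
      exact e.apply_symm_apply z
    rw [map_add, h, add_sub_cancel]

/-- The Lie bracket is compatible with related vector fields. -/
theorem fderiv_lieBracket_of_related {P : E → F} {y₀ : E} (hP : ContDiffAt ℝ 2 P y₀)
    {X Y : F → F} (hX : DifferentiableAt ℝ X (P y₀)) (hY : DifferentiableAt ℝ Y (P y₀))
    {X' Y' : E → E} (hX' : DifferentiableAt ℝ X' y₀) (hY' : DifferentiableAt ℝ Y' y₀)
    (hXX' : ∀ᶠ y in 𝓝 y₀, fderiv ℝ P y (X' y) = X (P y))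
    (hYY' : ∀ᶠ y in 𝓝 y₀, fderiv ℝ P y (Y' y) = Y (P y)) :
    fderiv ℝ P y₀ (lieBracket ℝ X' Y' y₀) = lieBracket ℝ X Y (P y₀) := by
  have hdP := hP.differentiableAt two_ne_zero
  rw [fderiv_apply_lieBracket hP (by simp) hY' hX', EventuallyEq.fderiv_eq hXX',
    EventuallyEq.fderiv_eq hYY', fderiv_fun_comp y₀ hY hdP, fderiv_fun_comp y₀ hX hdP]
  simp [lieBracket, hXX'.self_of_nhds, hYY'.self_of_nhds]

/-- If a linear map annihilates the values of a one-form on two vector fields, then it maps the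
exterior derivative of the form to minus the value on the Lie bracket. -/
theorem extDeriv_of_eventually_eq_zero {a : E → E →L[ℝ] V} {y₀ : E}
    (ha : DifferentiableAt ℝ a y₀) {X Y : E → E} (hX : DifferentiableAt ℝ X y₀)
    (hY : DifferentiableAt ℝ Y y₀) (Λ : V →L[ℝ] V)
    (haX : ∀ᶠ y in 𝓝 y₀, Λ (a y (X y)) = 0) (haY : ∀ᶠ y in 𝓝 y₀, Λ (a y (Y y)) = 0) :
    Λ (extDeriv (fun y => ContinuousAlternatingMap.ofSubsingleton ℝ E V (0 : Fin 1) (a y)) y₀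
      ![X y₀, Y y₀]) = - Λ (a y₀ (lieBracket ℝ X Y y₀)) := by
  have hω : DifferentiableAt ℝ
      (fun y => ContinuousAlternatingMap.ofSubsingleton ℝ E V (0 : Fin 1) (a y)) y₀ :=
    (ContinuousAlternatingMap.ofSubsingletonLIE (𝕜 := ℝ) (E := E) (F := V)
      (0 : Fin 1)).differentiableAt.comp y₀ ha
  have hd : ∀ i, DifferentiableAt ℝ (![X, Y] i) y₀ := by
    intro i; fin_cases i <;> assumption
  have h := extDeriv_apply_vectorField hω hd
  have hv : (fun i => ![X, Y] i y₀) = ![X y₀, Y y₀] := by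
    ext i; fin_cases i <;> rfl
  rw [hv] at h
  rw [h]
  -- This removes the two derivative terms of the invariant formula for the exterior derivative,
  -- leaving the bracket term.
  have hz : ∀ Z : E → E, DifferentiableAt ℝ Z y₀ → (∀ᶠ y in 𝓝 y₀, Λ (a y (Z y)) = 0) →
      ∀ v, Λ (fderiv ℝ (fun y => a y (Z y)) y₀ v) = 0 := by
    intro Z hZ h0 v
    have h1 : fderiv ℝ (fun y => Λ (a y (Z y))) y₀ = Λ.comp (fderiv ℝ (fun y => a y (Z y)) y₀) := by
      rw [fderiv_fun_comp y₀ Λ.differentiableAt (ha.clm_apply hZ), Λ.fderiv]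
    rw [EventuallyEq.fderiv_eq (show (fun y => Λ (a y (Z y))) =ᶠ[𝓝 y₀] fun _ => (0 : V) from h0)]
      at h1
    simpa using (DFunLike.congr_fun h1 v).symm
  have e0 : (fun y => ContinuousAlternatingMap.ofSubsingleton ℝ E V (0 : Fin 1) (a y)
      ((0 : Fin 2).removeNth (fun i => ![X, Y] i y))) = fun y => a y (Y y) := rfl
  have e1 : (fun y => ContinuousAlternatingMap.ofSubsingleton ℝ E V (0 : Fin 1) (a y)
      ((1 : Fin 2).removeNth (fun i => ![X, Y] i y))) = fun y => a y (X y) := rfl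
  rw [Fin.sum_univ_two, e0, e1]
  simp only [map_sub, map_add, map_zsmul, hz X hX haX, hz Y hY haY]
  simp

end Flat

/-! ### Vector fields, brackets and one-forms in a chart. -/

section Charts

variable {E : Type*} [NormedAddCommGroup E] [NormedSpace ℝ E]
  {N : Type*} [TopologicalSpace N] [ChartedSpace E N] [IsManifold 𝓘(ℝ, E) ∞ N]

theorem mfderiv_extChartAt_symm_apply {x q : N} (hq : q ∈ (extChartAt 𝓘(ℝ, E) x).source)
    (v : TangentSpace 𝓘(ℝ, E) q) :
    mfderiv 𝓘(ℝ, E) 𝓘(ℝ, E) (extChartAt 𝓘(ℝ, E) x).symm (extChartAt 𝓘(ℝ, E) x q)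
      (mfderiv 𝓘(ℝ, E) 𝓘(ℝ, E) (extChartAt 𝓘(ℝ, E) x) q v) = v := by
  have : IsManifold 𝓘(ℝ, E) 1 N := .of_le (n := ∞) (by simp)
  have h := mfderivWithin_extChartAt_symm_comp_mfderiv_extChartAt' (I := 𝓘(ℝ, E)) hq
  rw [ModelWithCorners.range_eq_univ, mfderivWithin_univ] at h
  exact DFunLike.congr_fun h v

theorem extChartAt_apply_mfderiv_symm {x : N} {z : E} (hz : z ∈ (extChartAt 𝓘(ℝ, E) x).target)
    (v : E) :
    mfderiv 𝓘(ℝ, E) 𝓘(ℝ, E) (extChartAt 𝓘(ℝ, E) x) ((extChartAt 𝓘(ℝ, E) x).symm z)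
      (mfderiv 𝓘(ℝ, E) 𝓘(ℝ, E) (extChartAt 𝓘(ℝ, E) x).symm z v) = v := by
  have : IsManifold 𝓘(ℝ, E) 1 N := .of_le (n := ∞) (by simp)
  have h := mfderiv_extChartAt_comp_mfderivWithin_extChartAt_symm (I := 𝓘(ℝ, E)) hz
  rw [ModelWithCorners.range_eq_univ, mfderivWithin_univ] at h
  exact DFunLike.congr_fun h v

theorem isInvertible_mfderiv_chart {x q : N} (hq : q ∈ (extChartAt 𝓘(ℝ, E) x).source) :
    (mfderiv 𝓘(ℝ, E) 𝓘(ℝ, E) (extChartAt 𝓘(ℝ, E) x) q).IsInvertible :=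
  have : IsManifold 𝓘(ℝ, E) 1 N := .of_le (n := ∞) (by simp)
  isInvertible_mfderiv_extChartAt hq

theorem isInvertible_mfderiv_chart_symm {x : N} {z : E}
    (hz : z ∈ (extChartAt 𝓘(ℝ, E) x).target) :
    (mfderiv 𝓘(ℝ, E) 𝓘(ℝ, E) (extChartAt 𝓘(ℝ, E) x).symm z).IsInvertible := by
  have : IsManifold 𝓘(ℝ, E) 1 N := .of_le (n := ∞) (by simp)
  have h := isInvertible_mfderivWithin_extChartAt_symm (I := 𝓘(ℝ, E)) hz
  rwa [ModelWithCorners.range_eq_univ, mfderivWithin_univ] at h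

theorem contMDiffAt_extChartAt_symm {x : N} {z : E} (hz : z ∈ (extChartAt 𝓘(ℝ, E) x).target) :
    ContMDiffAt 𝓘(ℝ, E) 𝓘(ℝ, E) ∞ (extChartAt 𝓘(ℝ, E) x).symm z :=
  (contMDiffOn_extChartAt_symm x).contMDiffAt ((isOpen_extChartAt_target x).mem_nhds hz)

/-- The coordinate expression of a vector field in the chart at `x`. -/
noncomputable def chartField (x : N) (X : ∀ q : N, TangentSpace 𝓘(ℝ, E) q) : E → E :=
  mpullback 𝓘(ℝ, E) 𝓘(ℝ, E) (extChartAt 𝓘(ℝ, E) x).symm X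

theorem chartField_apply {x q : N} (hq : q ∈ (extChartAt 𝓘(ℝ, E) x).source)
    (X : ∀ q : N, TangentSpace 𝓘(ℝ, E) q) :
    chartField x X (extChartAt 𝓘(ℝ, E) x q) =
      mfderiv 𝓘(ℝ, E) 𝓘(ℝ, E) (extChartAt 𝓘(ℝ, E) x) q (X q) := by
  obtain ⟨z, hz, rfl⟩ : ∃ z ∈ (extChartAt 𝓘(ℝ, E) x).target, (extChartAt 𝓘(ℝ, E) x).symm z = q :=
    ⟨_, (extChartAt 𝓘(ℝ, E) x).map_source hq, (extChartAt 𝓘(ℝ, E) x).left_inv hq⟩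
  rw [(extChartAt 𝓘(ℝ, E) x).right_inv hz]
  obtain ⟨e, he⟩ := isInvertible_mfderiv_chart_symm hz
  have h := extChartAt_apply_mfderiv_symm hz (chartField x X z)
  rw [← h]
  congr 1
  unfold chartField
  rw [mpullback_apply, ← he, ContinuousLinearMap.inverse_equiv]
  exact e.apply_symm_apply _

theorem differentiableAt_chartField [CompleteSpace E] {x : N} {U : Set N} (hU : IsOpen U)
    (hx : x ∈ U) {X : ∀ q : N, TangentSpace 𝓘(ℝ, E) q} (hX : SmoothFieldOn X U) :
    DifferentiableAt ℝ (chartField x X) (extChartAt 𝓘(ℝ, E) x x) := by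
  have : IsManifold 𝓘(ℝ, E) 1 N := .of_le (n := ∞) (by simp)
  have hz := mem_extChartAt_target (I := 𝓘(ℝ, E)) x
  have hX' : MDifferentiableAt 𝓘(ℝ, E) 𝓘(ℝ, E).tangent
      (fun q => (⟨q, X q⟩ : TangentBundle 𝓘(ℝ, E) N))
      ((extChartAt 𝓘(ℝ, E) x).symm (extChartAt 𝓘(ℝ, E) x x)) := by
    rw [extChartAt_to_inv]
    exact (hX.contMDiffAt (hU.mem_nhds hx)).mdifferentiableAt (by simp)
  have h := MDifferentiableAt.mpullback_vectorField (n := ∞) hX' (contMDiffAt_extChartAt_symm hz)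
    (isInvertible_mfderiv_chart_symm hz) (WithTop.coe_le_coe.2 le_top)
  exact (((contMDiff_snd_tangentBundle_modelSpace E 𝓘(ℝ, E) (n := 1)).mdifferentiableAt
    one_ne_zero).comp _ h).differentiableAt

theorem mlieBracket_eq_chartField (x : N) (X Y : ∀ q : N, TangentSpace 𝓘(ℝ, E) q) :
    mfderiv 𝓘(ℝ, E) 𝓘(ℝ, E) (extChartAt 𝓘(ℝ, E) x) x (mlieBracket 𝓘(ℝ, E) X Y x) =
      lieBracket ℝ (chartField x X) (chartField x Y) (extChartAt 𝓘(ℝ, E) x x) := by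
  obtain ⟨e, he⟩ := isInvertible_mfderiv_chart (mem_extChartAt_source (I := 𝓘(ℝ, E)) x)
  have h : mlieBracket 𝓘(ℝ, E) X Y x =
      (mfderiv 𝓘(ℝ, E) 𝓘(ℝ, E) (extChartAt 𝓘(ℝ, E) x) x).inverse
        (lieBracket (E := E) ℝ (chartField x X) (chartField x Y) (extChartAt 𝓘(ℝ, E) x x)) := by
    rw [mlieBracket, mlieBracketWithin_apply, ModelWithCorners.range_eq_univ, mpullbackWithin_univ,
      mpullbackWithin_univ, Set.preimage_univ, Set.univ_inter]
    exact congrArg _ (congrFun lieBracketWithin_univ _)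
  rw [h, ← he, ContinuousLinearMap.inverse_equiv]
  exact e.apply_symm_apply _

/-- In finite dimension it suffices to evaluate on constant vectors `v`; the result is the form
composed with the tangent map of the inverse chart along the section `y ↦ (y, v)`. -/
theorem differentiableAt_chart_form [FiniteDimensional ℝ E] {V : Type*} [NormedAddCommGroup V]
    [NormedSpace ℝ V] {α : ∀ q : N, TangentSpace 𝓘(ℝ, E) q →L[ℝ] V}
    (hα : ContMDiff 𝓘(ℝ, E).tangent 𝓘(ℝ, V) ∞
      (fun v : TangentBundle 𝓘(ℝ, E) N => α v.proj v.snd)) (x : N) :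
    DifferentiableAt ℝ (fun y : E => ((α ((extChartAt 𝓘(ℝ, E) x).symm y)).comp
      (mfderiv 𝓘(ℝ, E) 𝓘(ℝ, E) (extChartAt 𝓘(ℝ, E) x).symm y) : E →L[ℝ] V))
      (extChartAt 𝓘(ℝ, E) x x) := by
  have : IsManifold 𝓘(ℝ, E) 1 N := .of_le (n := ∞) (by simp)
  have hopen := isOpen_extChartAt_target (I := 𝓘(ℝ, E)) x
  have hz := mem_extChartAt_target (I := 𝓘(ℝ, E)) x
  refine ContDiffAt.differentiableAt (n := ∞) (ContDiffOn.contDiffAt ?_ (hopen.mem_nhds hz))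
    (by simp)
  rw [contDiffOn_clm_apply]
  intro v
  rw [← contMDiffOn_iff_contDiffOn]
  have hT := (contMDiffOn_extChartAt_symm (I := 𝓘(ℝ, E)) (n := ∞) x).contMDiffOn_tangentMapWithin
    (m := ∞) (by simp) hopen.uniqueMDiffOn
  have hc : ContMDiff 𝓘(ℝ, E) 𝓘(ℝ, E).tangent ∞
      (fun y : E => (⟨y, v⟩ : TangentBundle 𝓘(ℝ, E) E)) :=
    contMDiff_vectorSpace_iff_contDiff.2 contDiff_const
  have h := hα.comp_contMDiffOn (hT.comp hc.contMDiffOn (s := (extChartAt 𝓘(ℝ, E) x).target)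
    (fun y hy => hy))
  refine h.congr fun y hy => ?_
  simp only [Function.comp, tangentMapWithin]
  rw [mfderivWithin_of_isOpen hopen hy]
  rfl

end Charts

/-! ### The exterior derivative on vectors lifted through a submersion. -/

section Related

variable {EM : Type*} [NormedAddCommGroup EM] [NormedSpace ℝ EM] [FiniteDimensional ℝ EM]
  {M : Type*} [TopologicalSpace M] [ChartedSpace EM M] [IsManifold 𝓘(ℝ, EM) ∞ M]
  {EB : Type*} [NormedAddCommGroup EB] [NormedSpace ℝ EB] [FiniteDimensional ℝ EB]
  {B : Type*} [TopologicalSpace B] [ChartedSpace EB B] [IsManifold 𝓘(ℝ, EB) ∞ B]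
  {V : Type*} [NormedAddCommGroup V] [NormedSpace ℝ V] {p : B → M}

/-- Let `p : B → M` be a submersion at `u`, and let `Λ ∘ α` vanish on all vectors that project to
values of the vector fields `X` and `Y` on `M`. On such vectors at `u`, the exterior derivative of
`Λ ∘ α` is, up to sign, the value of `Λ ∘ α` on a vector that projects to the value of `[X, Y]`. -/
theorem exists_exteriorDerivative_eq (hp : ContMDiff 𝓘(ℝ, EB) 𝓘(ℝ, EM) ∞ p) {u : B}
    (hs : Function.Surjective (mfderiv 𝓘(ℝ, EB) 𝓘(ℝ, EM) p u))
    {α : ∀ b : B, TangentSpace 𝓘(ℝ, EB) b →L[ℝ] V}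
    (hα : ContMDiff 𝓘(ℝ, EB).tangent 𝓘(ℝ, V) ∞
      (fun v : TangentBundle 𝓘(ℝ, EB) B => α v.proj v.snd))
    (Λ : V →L[ℝ] V) {U : Set M} (hU : IsOpen U) (hu : p u ∈ U)
    {X Y : ∀ x : M, TangentSpace 𝓘(ℝ, EM) x} (hX : SmoothFieldOn X U) (hY : SmoothFieldOn Y U)
    (hαX : ∀ b, p b ∈ U → ∀ ζ, mfderiv 𝓘(ℝ, EB) 𝓘(ℝ, EM) p b ζ = X (p b) → Λ (α b ζ) = 0)
    (hαY : ∀ b, p b ∈ U → ∀ ζ, mfderiv 𝓘(ℝ, EB) 𝓘(ℝ, EM) p b ζ = Y (p b) → Λ (α b ζ) = 0)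
    {ξ η : TangentSpace 𝓘(ℝ, EB) u} (hξ : mfderiv 𝓘(ℝ, EB) 𝓘(ℝ, EM) p u ξ = X (p u))
    (hη : mfderiv 𝓘(ℝ, EB) 𝓘(ℝ, EM) p u η = Y (p u)) :
    ∃ ζ : TangentSpace 𝓘(ℝ, EB) u,
      mfderiv 𝓘(ℝ, EB) 𝓘(ℝ, EM) p u ζ = mlieBracket 𝓘(ℝ, EM) X Y (p u) ∧
      Λ (exteriorDerivative α u ξ η) = - Λ (α u ζ) := by
  have : CompleteSpace EM := FiniteDimensional.complete ℝ EM
  set φ := extChartAt 𝓘(ℝ, EB) u with hφ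
  set ψ := extChartAt 𝓘(ℝ, EM) (p u) with hψ
  have hφu : φ.symm (φ u) = u := extChartAt_to_inv u
  have hy₀ : φ u ∈ φ.target := mem_extChartAt_target u
  have hus : u ∈ φ.source := mem_extChartAt_source u
  have hpu : p u ∈ ψ.source := mem_extChartAt_source (p u)
  have hpd : ∀ b, MDifferentiableAt 𝓘(ℝ, EB) 𝓘(ℝ, EM) p b := fun b =>
    hp.mdifferentiableAt (by simp)
  let P : EB → EM := fun y => ψ (p (φ.symm y))
  have hP₀ : P (φ u) = ψ (p u) := by simp only [P, hφu]
  have hφd : MDifferentiableAt 𝓘(ℝ, EB) 𝓘(ℝ, EB) φ u :=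
    (contMDiffAt_extChartAt (n := 1)).mdifferentiableAt one_ne_zero
  have hψd : ∀ q ∈ ψ.source, MDifferentiableAt 𝓘(ℝ, EM) 𝓘(ℝ, EM) ψ q := fun q hq =>
    (contMDiffAt_extChartAt' (n := ∞)
      (by rwa [hψ, extChartAt_source] at hq)).mdifferentiableAt (by simp)
  have hφsd : ∀ y ∈ φ.target, MDifferentiableAt 𝓘(ℝ, EB) 𝓘(ℝ, EB) φ.symm y := fun y hy =>
    (contMDiffAt_extChartAt_symm hy).mdifferentiableAt (by simp)
  have hPc : ContDiffAt ℝ 2 P (φ u) := by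
    refine ContDiffAt.of_le (n := ∞) ?_ (WithTop.coe_le_coe.2 le_top)
    rw [← contMDiffAt_iff_contDiffAt]
    refine ContMDiffAt.comp (I' := 𝓘(ℝ, EM)) (g := ψ) _ ?_
      (hp.contMDiffAt.comp _ (contMDiffAt_extChartAt_symm hy₀))
    simp only [hφu]
    exact contMDiffAt_extChartAt
  have hev : ∀ᶠ y in 𝓝 (φ u), y ∈ φ.target ∧ p (φ.symm y) ∈ ψ.source ∧ p (φ.symm y) ∈ U := by
    have h1 : ContinuousAt (fun y => p (φ.symm y)) (φ u) :=
      hp.continuous.continuousAt.comp (continuousAt_extChartAt_symm u)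
    have h2 : ∀ᶠ q in 𝓝 (p (φ.symm (φ u))), q ∈ ψ.source ∧ q ∈ U := by
      rw [hφu]
      exact Filter.Eventually.and ((isOpen_extChartAt_source _).mem_nhds hpu) (hU.mem_nhds hu)
    exact Filter.Eventually.and (extChartAt_target_mem_nhds u) (h1.eventually h2)
  have hchain : ∀ y ∈ φ.target, p (φ.symm y) ∈ ψ.source → ∀ v : EB, fderiv ℝ P y v =
      mfderiv 𝓘(ℝ, EM) 𝓘(ℝ, EM) ψ (p (φ.symm y)) (mfderiv 𝓘(ℝ, EB) 𝓘(ℝ, EM) p (φ.symm y)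
        (mfderiv 𝓘(ℝ, EB) 𝓘(ℝ, EB) φ.symm y v)) := by
    intro y hy hq v
    rw [← mfderiv_eq_fderiv]
    have h1 := mfderiv_comp (I' := 𝓘(ℝ, EB)) (g := p) y (hpd _) (hφsd y hy)
    have h2 := mfderiv_comp (I' := 𝓘(ℝ, EM)) (g := ψ) (f := p ∘ φ.symm) y (hψd _ hq)
      ((hpd _).comp y (hφsd y hy))
    rw [h1] at h2
    exact DFunLike.congr_fun h2 v
  -- Derived from `P ∘ φ = ψ ∘ p` near `u` rather than from `hchain`, which would give tangent
  -- vectors at `φ.symm (φ u)` instead of `u`.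
  have hchain₀ : ∀ v : TangentSpace 𝓘(ℝ, EB) u,
      fderiv ℝ P (φ u) (mfderiv 𝓘(ℝ, EB) 𝓘(ℝ, EB) φ u v) =
      mfderiv 𝓘(ℝ, EM) 𝓘(ℝ, EM) ψ (p u) (mfderiv 𝓘(ℝ, EB) 𝓘(ℝ, EM) p u v) := by
    intro v
    have h1 := mfderiv_comp (I' := 𝓘(ℝ, EB)) (g := P) u
      (hPc.differentiableAt two_ne_zero).mdifferentiableAt hφd
    have h2 := mfderiv_comp (I' := 𝓘(ℝ, EM)) (g := ψ) u (hψd _ hpu) (hpd u)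
    have h3 : P ∘ φ =ᶠ[𝓝 u] ψ ∘ p := by
      filter_upwards [extChartAt_source_mem_nhds (I := 𝓘(ℝ, EB)) u] with b hb
      simp only [P, Function.comp, φ.left_inv hb]
    have h4 := DFunLike.congr_fun (h1.symm.trans (h3.mfderiv_eq.trans h2)) v
    rw [mfderiv_eq_fderiv] at h4
    exact h4
  have hinjψ : ∀ q ∈ ψ.source, Function.Injective (mfderiv 𝓘(ℝ, EM) 𝓘(ℝ, EM) ψ q) := by
    intro q hq
    obtain ⟨e, he⟩ := isInvertible_mfderiv_chart hq
    rw [← he]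
    exact e.injective
  have hsurjP : Function.Surjective (fderiv ℝ P (φ u)) := by
    intro w
    obtain ⟨e, he⟩ := isInvertible_mfderiv_chart hpu
    obtain ⟨v, hv⟩ := hs (e.symm w)
    refine ⟨mfderiv 𝓘(ℝ, EB) 𝓘(ℝ, EB) φ u v, (hchain₀ v).trans ?_⟩
    rw [hv, ← he]
    exact e.apply_symm_apply w
  have hfield : ∀ (Z : ∀ x : M, TangentSpace 𝓘(ℝ, EM) x), SmoothFieldOn Z U →
      (∀ b, p b ∈ U → ∀ ζ, mfderiv 𝓘(ℝ, EB) 𝓘(ℝ, EM) p b ζ = Z (p b) → Λ (α b ζ) = 0) →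
      ∀ v : TangentSpace 𝓘(ℝ, EB) u, mfderiv 𝓘(ℝ, EB) 𝓘(ℝ, EM) p u v = Z (p u) →
      DifferentiableAt ℝ (chartField (p u) Z) (P (φ u)) ∧
      ∃ Z' : EB → EB, DifferentiableAt ℝ Z' (φ u) ∧
        Z' (φ u) = mfderiv 𝓘(ℝ, EB) 𝓘(ℝ, EB) φ u v ∧
        (∀ᶠ y in 𝓝 (φ u), fderiv ℝ P y (Z' y) = chartField (p u) Z (P y)) ∧
        ∀ᶠ y in 𝓝 (φ u), Λ (α (φ.symm y) (mfderiv 𝓘(ℝ, EB) 𝓘(ℝ, EB) φ.symm y (Z' y))) = 0 := by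
    intro Z hZ hαZ v hv
    have hd : DifferentiableAt ℝ (chartField (p u) Z) (P (φ u)) := by
      rw [hP₀]
      exact differentiableAt_chartField hU hu hZ
    obtain ⟨Z', h1, h2, h3⟩ := exists_related_vectorField hPc hsurjP hd
      (v₀ := mfderiv 𝓘(ℝ, EB) 𝓘(ℝ, EB) φ u v) (by
        rw [hP₀, chartField_apply hpu, ← hv]
        exact hchain₀ v)
    refine ⟨hd, Z', h1, h2, h3, ?_⟩
    filter_upwards [hev, h3] with y ⟨hy, hq, hqU⟩ h
    -- The coordinate relation between `Z'` and `Z` becomes a relation on `M` because the derivative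
    -- of `ψ` is injective.
    refine hαZ _ hqU _ (hinjψ _ hq ?_)
    rw [hchain y hy hq] at h
    exact h.trans (chartField_apply hq Z)
  obtain ⟨hdX, X', hX'd, hX'v, hX'r, hX'0⟩ := hfield X hX hαX ξ hξ
  obtain ⟨hdY, Y', hY'd, hY'v, hY'r, hY'0⟩ := hfield Y hY hαY η hη
  obtain ⟨e, he⟩ := isInvertible_mfderiv_chart hus
  set w := lieBracket ℝ X' Y' (φ u)
  have hζ : mfderiv 𝓘(ℝ, EB) 𝓘(ℝ, EB) φ u (e.symm w) = w := by
    rw [← he]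
    exact e.apply_symm_apply w
  refine ⟨e.symm w, hinjψ _ hpu ?_, ?_⟩
  · rw [mlieBracket_eq_chartField, ← hchain₀, hζ, ← hψ, ← hP₀]
    exact fderiv_lieBracket_of_related hPc hdX hdY hX'd hY'd hX'r hY'r
  · have h := extDeriv_of_eventually_eq_zero (differentiableAt_chart_form hα u) hX'd hY'd Λ
      hX'0 hY'0
    rw [hX'v, hY'v] at h
    refine h.trans ?_
    -- Transport along `φ.symm (φ u) = u`; all tangent spaces are the model space `EB` by
    -- definition.
    have htr : ∀ b : B, b = u → ∀ (v : TangentSpace 𝓘(ℝ, EB) b) (v' : TangentSpace 𝓘(ℝ, EB) u),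
        (v : EB) = v' → α b v = α u v' := by
      rintro b rfl v v' h; exact congrArg _ h
    congr 2
    refine htr _ hφu _ _ ?_
    have h5 := mfderiv_extChartAt_symm_apply hus (e.symm w)
    rw [hζ] at h5
    exact h5

end Related

/-! ### Projections of the graded Lie algebra. -/

namespace EffectiveGrading

variable {L : Type*} [LieRing L] [LieAlgebra ℝ L] {k : ℕ} (gr : EffectiveGrading L k)

theorem proj_mem (i : ℤ) (x : L) : gr.proj i x ∈ gr.piece i := Subtype.prop _

theorem proj_of_mem {i : ℤ} {x : L} (hx : x ∈ gr.piece i) (j : ℤ) :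
    gr.proj j x = if i = j then x else 0 := by
  have h : (LinearEquiv.ofBijective (DirectSum.coeLinearMap gr.piece) gr.isInternal).symm x =
      DirectSum.lof ℝ ℤ (fun i => gr.piece i) i ⟨x, hx⟩ := by
    rw [LinearEquiv.symm_apply_eq]
    exact (DirectSum.coeLinearMap_lof gr.piece i ⟨x, hx⟩).symm
  simp only [proj, LinearMap.comp_apply, LinearEquiv.coe_coe, h]
  split_ifs with hij
  · subst hij
    rw [DirectSum.component.lof_self]; rfl
  · rw [DirectSum.component.of, dif_neg hij]; rfl

theorem proj_eq_zero_of_lt {i : ℤ} (hi : (k : ℤ) < |i|) (x : L) : gr.proj i x = 0 := by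
  have h := gr.proj_mem i x
  rwa [gr.eq_bot i hi, Submodule.mem_bot] at h

theorem sum_proj (x : L) : ∑ i ∈ Finset.Icc (-(k : ℤ)) k, gr.proj i x = x := by
  have h : (⊤ : Submodule ℝ L) ≤
      LinearMap.eqLocus (∑ i ∈ Finset.Icc (-(k : ℤ)) k, gr.proj i) LinearMap.id := by
    rw [← gr.isInternal.submodule_iSup_eq_top, iSup_le_iff]
    intro i x hx
    rw [LinearMap.mem_eqLocus, LinearMap.sum_apply, LinearMap.id_apply]
    simp_rw [gr.proj_of_mem hx]
    rw [Finset.sum_ite_eq]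
    split_ifs with hi
    · rfl
    · have hk : (k : ℤ) < |i| := by
        rwa [Finset.mem_Icc, ← abs_le, not_le] at hi
      rw [gr.eq_bot i hk] at hx
      exact ((Submodule.mem_bot ℝ).1 hx).symm
  have h' := LinearMap.mem_eqLocus.1 (h (Submodule.mem_top (x := x)))
  simpa using h'

theorem negProj_of_mem {x : L} (hx : x ∈ gr.neg) : gr.negProj x = x := by
  have h : gr.neg ≤ LinearMap.eqLocus gr.negProj LinearMap.id := by
    refine iSup₂_le fun i hi x hx => ?_
    rw [LinearMap.mem_eqLocus, negProj, LinearMap.sum_apply, LinearMap.id_apply]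
    simp_rw [gr.proj_of_mem hx]
    rw [Finset.sum_ite_eq]
    split_ifs with hi'
    · rfl
    · have hk : (k : ℤ) < |i| := by
        rw [Finset.mem_Icc] at hi'
        rw [abs_of_neg hi]
        omega
      rw [gr.eq_bot i hk] at hx
      exact ((Submodule.mem_bot ℝ).1 hx).symm
  exact h hx

theorem proj_negProj {i : ℤ} (hi : i < 0) (x : L) : gr.proj i (gr.negProj x) = gr.proj i x := by
  rw [negProj, LinearMap.sum_apply, map_sum]
  simp_rw [gr.proj_of_mem (gr.proj_mem _ x)]
  rw [Finset.sum_ite_eq']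
  split_ifs with h
  · rfl
  · rw [Finset.mem_Icc] at h
    refine (gr.proj_eq_zero_of_lt ?_ x).symm
    rw [abs_of_neg hi]
    omega

theorem negProj_congr {x y : L} (h : ∀ i < 0, gr.proj i x = gr.proj i y) :
    gr.negProj x = gr.negProj y := by
  rw [negProj, LinearMap.sum_apply, LinearMap.sum_apply]
  refine Finset.sum_congr rfl fun i hi => h i ?_
  rw [Finset.mem_Icc] at hi
  omega

/-- The lowest component of a Lie bracket. -/
theorem proj_lie {i j m : ℤ} {x y : L} (hx : ∀ l < i, gr.proj l x = 0)
    (hy : ∀ l < j, gr.proj l y = 0) (hm : m ≤ i + j) :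
    gr.proj m ⁅x, y⁆ = if m = i + j then ⁅gr.proj i x, gr.proj j y⁆ else 0 := by
  -- Only `a ≥ i` and `b ≥ j` contribute, so `a + b = m ≤ i + j` forces `a = i` and `b = j`.
  have key : ∀ a b, gr.proj m ⁅gr.proj a x, gr.proj b y⁆ =
      if a = i then if b = j then if m = i + j then ⁅gr.proj i x, gr.proj j y⁆ else 0 else 0
        else 0 := by
    intro a b
    rcases lt_or_ge a i with ha | ha
    · rw [hx a ha, if_neg ha.ne, zero_lie, map_zero]
    rcases lt_or_ge b j with hb | hb
    · rw [hy b hb, if_neg hb.ne, lie_zero, map_zero, ite_self]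
    rw [gr.proj_of_mem (gr.lie_mem a b _ _ (gr.proj_mem a x) (gr.proj_mem b y))]
    by_cases h : a + b = m
    · obtain rfl : a = i := by omega
      obtain rfl : b = j := by omega
      simp [h]
    · rw [if_neg h]
      split_ifs <;> first | rfl | omega
  have hsum : gr.proj m ⁅x, y⁆ = ∑ a ∈ Finset.Icc (-(k : ℤ)) k, ∑ b ∈ Finset.Icc (-(k : ℤ)) k,
      gr.proj m ⁅gr.proj a x, gr.proj b y⁆ := by
    conv_lhs => rw [← gr.sum_proj x, ← gr.sum_proj y, sum_lie]
    simp only [map_sum, lie_sum]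
  rw [hsum]
  simp_rw [key]
  simp only [Finset.sum_ite_eq', Finset.sum_ite_irrel, Finset.sum_const_zero]
  split_ifs with h1 h2 h3 h4 h5
  all_goals try rfl
  -- The degrees `i`, `j` may lie outside `[-k, k]`; the pieces there are zero.
  · rw [gr.proj_eq_zero_of_lt (i := j), lie_zero]
    rwa [Finset.mem_Icc, ← abs_le, not_le] at h2
  · rw [gr.proj_eq_zero_of_lt (i := i), zero_lie]
    rwa [Finset.mem_Icc, ← abs_le, not_le] at h1

end EffectiveGrading

/-! ### Submersivity of principal bundles and sections of subbundles. -/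

section Bundles

variable {EM : Type*} [NormedAddCommGroup EM] [NormedSpace ℝ EM]
  {M : Type*} [TopologicalSpace M] [ChartedSpace EM M]
  {EB : Type*} [NormedAddCommGroup EB] [NormedSpace ℝ EB]
  {B : Type*} [TopologicalSpace B] [ChartedSpace EB B]

/-- A local trivialization gives a local section `z ↦ φ (z, h)` through `u`; its derivative is a
right inverse. -/
theorem IsPrincipalBundle.surjective_mfderiv {EH : Type*} [NormedAddCommGroup EH]
    [NormedSpace ℝ EH] {H : Type*} [TopologicalSpace H] [ChartedSpace EH H] [Group H]
    [MulAction Hᵐᵒᵖ B] {p : B → M}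
    (hp : IsPrincipalBundle (EM := EM) (EB := EB) (EH := EH) H p) (u : B) :
    Function.Surjective (mfderiv 𝓘(ℝ, EB) 𝓘(ℝ, EM) p u) := by
  obtain ⟨U, φ, hU, hx, hs, ht, hφ, -, hpφ, -⟩ := hp.locally_trivial (p u)
  have hut : u ∈ φ.target := by rw [ht]; exact hx
  obtain ⟨⟨y, h⟩, hyh, rfl⟩ : ∃ q ∈ φ.source, φ q = u :=
    ⟨φ.symm u, φ.map_target hut, φ.right_inv hut⟩
  have hy : y ∈ U := by rw [hs] at hyh; exact hyh.1
  have hsec : MDifferentiableAt 𝓘(ℝ, EM) 𝓘(ℝ, EB) (fun z => φ (z, h)) y := by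
    have h1 : ContMDiffAt 𝓘(ℝ, EM) 𝓘(ℝ, EB) ∞ (fun z => φ (z, h)) y :=
      ContMDiffAt.comp (g := φ) y (hφ.contMDiffAt (φ.open_source.mem_nhds hyh))
        (contMDiffAt_id.prodMk contMDiffAt_const)
    exact h1.mdifferentiableAt (by simp)
  have hpd : MDifferentiableAt 𝓘(ℝ, EB) 𝓘(ℝ, EM) p (φ (y, h)) :=
    hp.contMDiff_proj.mdifferentiableAt (by simp)
  have hc := mfderiv_comp (I' := 𝓘(ℝ, EB)) (g := p) y hpd hsec
  have he : p ∘ (fun z => φ (z, h)) =ᶠ[𝓝 y] id := by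
    filter_upwards [hU.mem_nhds hy] with z hz
    exact hpφ z hz h
  rw [he.mfderiv_eq, mfderiv_id] at hc
  intro v
  exact ⟨mfderiv 𝓘(ℝ, EM) 𝓘(ℝ, EB) (fun z => φ (z, h)) y v, (DFunLike.congr_fun hc v).symm⟩

variable [IsManifold 𝓘(ℝ, EM) ∞ M]

theorem IsSmoothSubbundle.exists_section {D : ∀ x : M, Submodule ℝ (TangentSpace 𝓘(ℝ, EM) x)}
    (hD : IsSmoothSubbundle D) {x : M} {v : TangentSpace 𝓘(ℝ, EM) x} (hv : v ∈ D x) :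
    ∃ (U : Set M) (X : ∀ y, D y), IsOpen U ∧ x ∈ U ∧
      SmoothFieldOn (fun y => (X y : TangentSpace 𝓘(ℝ, EM) y)) U ∧ (X x : TangentSpace 𝓘(ℝ, EM) x) = v := by
  classical
  have : IsManifold 𝓘(ℝ, EM) 1 M := .of_le (n := ∞) (by simp)
  obtain ⟨U, r, e, hU, hx, he, hspan⟩ := hD x
  rw [← (hspan x hx).2, Submodule.mem_span_range_iff_exists_fun] at hv
  obtain ⟨c, rfl⟩ := hv
  have hmem : ∀ y ∈ U, ∑ a, c a • e a y ∈ D y := by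
    intro y hy
    rw [← (hspan y hy).2]
    exact Submodule.sum_mem _ fun a _ => Submodule.smul_mem _ _ (Submodule.subset_span ⟨a, rfl⟩)
  -- A combination of the frame with constant coefficients, extended by zero because sections are
  -- defined on all of `M`.
  refine ⟨U, fun y => if hy : y ∈ U then ⟨_, hmem y hy⟩ else 0, hU, hx, ?_, by simp [hx]⟩
  have hsum : SmoothFieldOn (fun y => ∑ a, c a • e a y) U :=
    ContMDiffOn.sum_section fun a _ => (he a).const_smul_section
  refine hsum.congr fun y hy => ?_
  simp [hy]

end Bundles

/-! ### Weyl forms, the filtration and the lowest components of the curvature. -/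

section Flag

variable {EG : Type*} [NormedAddCommGroup EG] [NormedSpace ℝ EG] [FiniteDimensional ℝ EG]
  {G : Type*} [TopologicalSpace G] [ChartedSpace EG G] [Group G] [LieGroup 𝓘(ℝ, EG) ∞ G]
  {EM EB : Type*} {k : ℕ} {gr : EffectiveGrading (GroupLieAlgebra 𝓘(ℝ, EG) G) k}
  [NormedAddCommGroup EM] [NormedSpace ℝ EM]
  {M : Type*} [TopologicalSpace M] [ChartedSpace EM M] [IsManifold 𝓘(ℝ, EM) ∞ M]
  [NormedAddCommGroup EB] [NormedSpace ℝ EB]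
  {B : Type*} [TopologicalSpace B] [ChartedSpace EB B] [MulAction (levi gr)ᵐᵒᵖ B] {p : B → M}

theorem InfinitesimalFlagStructure.frameForm_eq_zero_iff
    (F : InfinitesimalFlagStructure EM EB gr p) {i : ℤ} (hi : i < 0) (u : B)
    (ξ : TangentSpace 𝓘(ℝ, EB) u)
    (hξ : mfderiv 𝓘(ℝ, EB) 𝓘(ℝ, EM) p u ξ ∈ F.filtration i (p u)) :
    F.frameForm i hi u ξ hξ = 0 ↔
      mfderiv 𝓘(ℝ, EB) 𝓘(ℝ, EM) p u ξ ∈ F.filtration (i + 1) (p u) := by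
  unfold InfinitesimalFlagStructure.frameForm
  rw [Submodule.coe_eq_zero, LinearEquiv.map_eq_zero_iff, Submodule.Quotient.mk_eq_zero]
  rfl

namespace WeylForm

variable [IsManifold 𝓘(ℝ, EB) ∞ B] {E₀ : Type*} [NormedAddCommGroup E₀] [NormedSpace ℝ E₀]
  {F : InfinitesimalFlagStructure EM EB gr p} [ChartedSpace E₀ (levi gr)] (τ : WeylForm E₀ F)

theorem proj_eq_zero {i l : ℤ} (hl : l < i) (hl0 : l < 0) (u : B) (ξ : TangentSpace 𝓘(ℝ, EB) u)
    (hξ : mfderiv 𝓘(ℝ, EB) 𝓘(ℝ, EM) p u ξ ∈ F.filtration i (p u)) :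
    gr.proj l (τ.toFun u ξ) = 0 := by
  rw [τ.eq_frameForm l hl0 u ξ (F.antitone (p u) hl.le hξ), F.frameForm_eq_zero_iff]
  exact F.antitone (p u) (Int.add_one_le_of_lt hl) hξ

/-- Climbing from `T^{-k} M = TM`: a vector over `T^i M` lies over `T^{i+1} M` as soon as `τ_i`,
which is the frame form there, vanishes on it. -/
theorem mem_filtration {i : ℤ} (hi : i ≤ 0) (u : B) (ξ : TangentSpace 𝓘(ℝ, EB) u)
    (hξ : ∀ l < i, gr.proj l (τ.toFun u ξ) = 0) :
    mfderiv 𝓘(ℝ, EB) 𝓘(ℝ, EM) p u ξ ∈ F.filtration i (p u) := by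
  rcases le_total i (-(k : ℤ)) with hik | hik
  · exact F.eq_top i hik _ ▸ Submodule.mem_top
  · induction i, hik using Int.leInduction with
    | base =>
      exact F.eq_top _ le_rfl _ ▸ Submodule.mem_top
    | succ i hik ih =>
      have h := ih (by omega) fun l hl => hξ l (by omega)
      rw [← F.frameForm_eq_zero_iff (by omega) u ξ h, ← τ.eq_frameForm, hξ i (by omega)]

/-- Correction from the lowest degree upwards: the frame and surjectivity of the derivative of `p`
match the lowest component, and the error committed in higher degrees is passed to the next step. -/
theorem exists_lift (u : B) (hs : Function.Surjective (mfderiv 𝓘(ℝ, EB) 𝓘(ℝ, EM) p u))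
    (X : GroupLieAlgebra 𝓘(ℝ, EG) G) :
    ∃ ξ : TangentSpace 𝓘(ℝ, EB) u, ∀ l < 0, gr.proj l (τ.toFun u ξ) = gr.proj l X := by
  have key : ∀ (n : ℕ) (X : GroupLieAlgebra 𝓘(ℝ, EG) G), (∀ l < -(n : ℤ), gr.proj l X = 0) →
      ∃ ξ : TangentSpace 𝓘(ℝ, EB) u, ∀ l < 0, gr.proj l (τ.toFun u ξ) = gr.proj l X := by
    intro n
    induction n with
    | zero =>
      intro X hX
      refine ⟨0, fun l hl => ?_⟩
      rw [map_zero, map_zero, hX l (by simpa using hl)]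
    | succ n ih =>
      intro X hX
      have hn : -((n + 1 : ℕ) : ℤ) < 0 := by omega
      obtain ⟨q, hq⟩ := (F.frame u rfl _ hn).surjective ⟨_, gr.proj_mem (-((n + 1 : ℕ) : ℤ)) X⟩
      obtain ⟨⟨v, hv⟩, rfl⟩ := Submodule.Quotient.mk_surjective _ q
      obtain ⟨ξ₁, rfl⟩ := hs v
      have h1 : gr.proj (-((n + 1 : ℕ) : ℤ)) (τ.toFun u ξ₁) = gr.proj (-((n + 1 : ℕ) : ℤ)) X := by
        rw [τ.eq_frameForm _ hn u ξ₁ hv]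
        exact congrArg Subtype.val hq
      obtain ⟨ξ₂, h2⟩ := ih (X - τ.toFun u ξ₁) (by
        intro l hl
        rw [map_sub, sub_eq_zero]
        rcases (show l = -((n + 1 : ℕ) : ℤ) ∨ l < -((n + 1 : ℕ) : ℤ) by omega) with rfl | hl'
        · exact h1.symm
        · rw [hX l hl', τ.proj_eq_zero hl' (hl'.trans hn) u ξ₁ hv])
      refine ⟨ξ₁ + ξ₂, fun l hl => ?_⟩
      rw [map_add, map_add, h2 l hl, map_sub, add_sub_cancel]
  refine key k X fun l hl => gr.proj_eq_zero_of_lt ?_ X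
  rw [abs_of_neg (by omega)]
  omega

theorem proj_curvature [FiniteDimensional ℝ EM] [FiniteDimensional ℝ EB]
    (hF : F.IsRegular) (hp : ContMDiff 𝓘(ℝ, EB) 𝓘(ℝ, EM) ∞ p) {u : B}
    (hs : Function.Surjective (mfderiv 𝓘(ℝ, EB) 𝓘(ℝ, EM) p u)) {i j m : ℤ} (hi : i < 0)
    (hj : j < 0) (hm : m ≤ i + j) {ξ η : TangentSpace 𝓘(ℝ, EB) u}
    (hξ : ∀ l < i, gr.proj l (τ.toFun u ξ) = 0) (hη : ∀ l < j, gr.proj l (τ.toFun u η) = 0) :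
    gr.proj m (τ.curvature u ξ η) = 0 := by
  have hξ' := τ.mem_filtration hi.le u ξ hξ
  have hη' := τ.mem_filtration hj.le u η hη
  obtain ⟨U₁, X, hU₁, hu₁, hX, hXu⟩ := (F.isSmoothSubbundle i).exists_section hξ'
  obtain ⟨U₂, Y, hU₂, hu₂, hY, hYu⟩ := (F.isSmoothSubbundle j).exists_section hη'
  have hX' : SmoothFieldOn (fun x => (X x : TangentSpace 𝓘(ℝ, EM) x)) (U₁ ∩ U₂) :=
    hX.mono Set.inter_subset_left
  have hY' : SmoothFieldOn (fun x => (Y x : TangentSpace 𝓘(ℝ, EM) x)) (U₁ ∩ U₂) :=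
    hY.mono Set.inter_subset_right
  let Λ : EG →L[ℝ] EG := LinearMap.toContinuousLinearMap (E := EG) (F' := EG) (gr.proj m)
  obtain ⟨ζ, hζ, hd⟩ := exists_exteriorDerivative_eq (V := EG) hp hs (α := τ.toFun) τ.smooth Λ
    (hU₁.inter hU₂) ⟨hu₁, hu₂⟩ hX' hY'
    -- Negativity of the other degree makes `m ≤ i + j` strictly smaller than `i`, and symmetrically
    -- than `j`.
    (fun b _ ζ hζ => τ.proj_eq_zero (i := i) (by omega) (by omega) b ζ (hζ ▸ (X (p b)).2))
    (fun b _ ζ hζ => τ.proj_eq_zero (i := j) (by omega) (by omega) b ζ (hζ ▸ (Y (p b)).2))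
    hXu.symm hYu.symm
  have hd' : gr.proj m (exteriorDerivative (V := EG) τ.toFun u ξ η :) =
    - gr.proj m (τ.toFun u ζ) := hd
  obtain ⟨hmem, hbr⟩ := hF i j hi hj _ (hU₁.inter hU₂) X Y hX' hY' (p u) ⟨hu₁, hu₂⟩
  have hζm : mfderiv 𝓘(ℝ, EB) 𝓘(ℝ, EM) p u ζ ∈ F.filtration (i + j) (p u) := hζ ▸ hmem
  have hproj : gr.proj m (τ.toFun u ζ) =
      if m = i + j then ⁅gr.proj i (τ.toFun u ξ), gr.proj j (τ.toFun u η)⁆ else 0 := by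
    split_ifs with h
    · subst h
      rw [τ.eq_frameForm _ (add_neg hi hj) u ζ hζm, τ.eq_frameForm i hi u ξ hξ',
        τ.eq_frameForm j hj u η hη']
      have h1 : (⟨_, hζm⟩ : F.filtration (i + j) (p u)) = ⟨_, hmem⟩ := Subtype.ext hζ
      have h2 : (⟨_, hξ'⟩ : F.filtration i (p u)) = X (p u) := Subtype.ext hXu.symm
      have h3 : (⟨_, hη'⟩ : F.filtration j (p u)) = Y (p u) := Subtype.ext hYu.symm
      unfold InfinitesimalFlagStructure.frameForm
      rw [h1, h2, h3]
      exact hbr u rfl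
    · exact τ.proj_eq_zero (lt_of_le_of_ne hm h) (by omega) u ζ hζm
  have hadd : gr.proj m (τ.curvature u ξ η) =
      gr.proj m (exteriorDerivative (V := EG) τ.toFun u ξ η :) +
        gr.proj m ⁅τ.toFun u ξ, τ.toFun u η⁆ := map_add _ _ _
  rw [hadd, hd', hproj, gr.proj_lie hξ hη hm, neg_add_cancel]

end WeylForm

end Flag

end WeylGeometry

/-! ### Existence of lifts and vanishing in nonpositive degrees. -/

theorem mainTheorem9
    {EG : Type*} [NormedAddCommGroup EG] [NormedSpace ℝ EG] [FiniteDimensional ℝ EG]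
    {G : Type*} [TopologicalSpace G] [ChartedSpace EG G] [Group G] [LieGroup 𝓘(ℝ, EG) ∞ G]
    {k : ℕ} (gr : WeylGeometry.EffectiveGrading (GroupLieAlgebra 𝓘(ℝ, EG) G) k)
    -- the structure of a Lie group on the closed subgroup `G₀` of `G`
    {E₀ : Type*} [NormedAddCommGroup E₀] [NormedSpace ℝ E₀] [FiniteDimensional ℝ E₀]
    [ChartedSpace E₀ (WeylGeometry.levi gr)] [LieGroup 𝓘(ℝ, E₀) ∞ (WeylGeometry.levi gr)]
    (_hG₀ : Manifold.IsSmoothEmbedding 𝓘(ℝ, E₀) 𝓘(ℝ, EG) ∞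
      (Subtype.val : WeylGeometry.levi gr → G))
    -- the base `M`, and the bundle `p : B → M`
    {EM : Type*} [NormedAddCommGroup EM] [NormedSpace ℝ EM] [FiniteDimensional ℝ EM]
    {M : Type*} [TopologicalSpace M] [ChartedSpace EM M] [IsManifold 𝓘(ℝ, EM) ∞ M]
    {EB : Type*} [NormedAddCommGroup EB] [NormedSpace ℝ EB] [FiniteDimensional ℝ EB]
    {B : Type*} [TopologicalSpace B] [ChartedSpace EB B] [IsManifold 𝓘(ℝ, EB) ∞ B]
    [MulAction (WeylGeometry.levi gr)ᵐᵒᵖ B] (p : B → M)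
    (_hp : WeylGeometry.IsPrincipalBundle (EM := EM) (EB := EB) (EH := E₀)
      (WeylGeometry.levi gr) p)
    (F : WeylGeometry.InfinitesimalFlagStructure EM EB gr p) (_hF : F.IsRegular)
    (τ : WeylGeometry.WeylForm E₀ F) (u : B) :
    (∃ σ : GroupLieAlgebra 𝓘(ℝ, EG) G → TangentSpace 𝓘(ℝ, EB) u, τ.IsLift u σ) ∧
    ∀ σ : GroupLieAlgebra 𝓘(ℝ, EG) G → TangentSpace 𝓘(ℝ, EB) u, τ.IsLift u σ →
      ∀ ℓ : ℤ, ℓ ≤ 0 → ∀ X ∈ gr.neg, ∀ Y ∈ gr.neg,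
        gr.homogeneousPart ℓ (τ.curvatureFunction u σ) X Y = 0 := by
  have hs := _hp.surjective_mfderiv u
  constructor
  · choose σ hσ using τ.exists_lift u hs
    exact ⟨σ, fun X hX => (gr.negProj_congr (hσ X)).trans (gr.negProj_of_mem hX)⟩
  · intro σ hσ ℓ hℓ X _ Y _
    -- The lifting condition controls only negative degrees, which suffices because `l < i < 0`.
    have hlift : ∀ i < 0, ∀ Z, ∀ l < i, gr.proj l (τ.toFun u (σ (gr.proj i Z))) = 0 := by
      intro i hi Z l hl
      have hneg : gr.proj i Z ∈ gr.neg :=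
        Submodule.mem_iSup_of_mem i (Submodule.mem_iSup_of_mem hi (gr.proj_mem i Z))
      rw [← gr.proj_negProj (hl.trans hi), hσ _ hneg, gr.proj_of_mem (gr.proj_mem i Z),
        if_neg hl.ne']
    refine Finset.sum_eq_zero fun i hi => Finset.sum_eq_zero fun j hj => ?_
    rw [Finset.mem_Icc] at hi hj
    exact τ.proj_curvature _hF _hp.contMDiff_proj hs (i := i) (j := j) (by omega) (by omega)
      (by omega) (hlift i (by omega) X) (hlift j (by omega) Y)
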